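/- Let $V\subseteq\mathbb{R}^{n+m}$ be a linear subspace of dimension $n$, $W=V^{\perp}$, and let $\pi:\mathbb{R}^{n+m}\to V$ and $\pi_W:\mathbb{R}^{n+m}\to W$ be the orthogonal projections. A convex body is a non-empty compact convex set, and $h_A(u)=\max_{x\in A}\langle u,x\rangle$ denotes the support function. For a convex body $K\subset\mathbb{R}^{n+m}$ and $x\in V$ put $K_x=\{y\in W: x+y\in K\}$; the fiber body of $K$ is $$\Sigma_\pi K=\Big\{\int_{\pi(K)}\gamma(x)\,dx \;:\; \gamma:\pi(K)\to W\ \text{Borel measurable},\ \gamma(x)\in K_x\ \text{for all } x\in\pi(K)\Big\}\subset W,$$ where $dx$ is the $n$-dimensional Lebesgue measure on $V$. Call $K$ curved if $h_K$ is $C^2$ on $\mathbb{R}^{n+m}\setminus\{0\}$ and $\nabla h_K$ restricted to the unit sphere is a $C^1$ diffeomorphism onto its image. **Theorem.** Let $K\subset\mathbb{R}^{n+m}$ be a curved convex body. For $u\in W$ let $\psi_u:V\to V$, $\psi_u(\xi)=\pi(\nabla h_K(u+\xi))$, and let $J_{\psi_u}(\xi)$ be the determinant of the differential of $\psi_u$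 at $\xi$. Then for every $u\in W$ the maximum defining $h_{\Sigma_\pi K}(u)$ is attained, the integrand below is integrable, and $$h_{\Sigma_\pi K}(u)=\int_V\langle u,\nabla h_K(u+\xi)\rangle\, J_{\psi_u}(\xi)\,d\xi .$$ Moreover, for every $u\in W$ with $\|u\|=1$ the function $h_{\Sigma_\pi K}:W\to\mathbb{R}$ is differentiable at $u$, and $$\nabla h_{\Sigma_\pi K}(u)=\int_V \pi_W\big(\nabla h_K(u+\xi)\big)\, J_{\psi_u}(\xi)\,d\xi ,$$ with integrable integrand. (For $u=0$, where $\nabla h_K(u+\xi)$ may be undefined at $\xi=0$, the first integrand is read as $0$.) -/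

import Mathlib

open MeasureTheory

noncomputable section

/-- The support function `h_A(u) = max {⟪u, x⟫ : x ∈ A}` of a set `A`, written as a supremum; for a
non-empty compact `A` the supremum is attained, so it is the maximum. -/
def supportFunction {F : Type*} [NormedAddCommGroup F] [InnerProductSpace ℝ F]
    (A : Set F) (u : F) : ℝ :=
  sSup ((fun x : F => inner ℝ u x) '' A)

/-- `f` restricts to a `C¹` diffeomorphism of `s` onto its image `f '' s`: it is `C¹` along `s` and
has an inverse `g : f '' s → s` that is `C¹` along `f '' s` (in particular `f` is injective on
`s`). It is used for the unit sphere `s`. -/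
def IsC1DiffeoOnImage {F G : Type*} [NormedAddCommGroup F] [NormedSpace ℝ F]
    [NormedAddCommGroup G] [NormedSpace ℝ G] (f : F → G) (s : Set F) : Prop :=
  ContDiffOn ℝ 1 f s ∧ ∃ g : G → F, Set.LeftInvOn g f s ∧ ContDiffOn ℝ 1 g (f '' s)

variable {E : Type*} [NormedAddCommGroup E] [InnerProductSpace ℝ E] [FiniteDimensional ℝ E]

/-- A convex body is curved if its support function is `C²` away from the origin and the gradient
of the support function restricts to a `C¹` diffeomorphism of the unit sphere onto its image.
(A support function is positively homogeneous of degree one, so its smoothness is always meant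
on the complement of the origin.) -/
def IsCurved (K : ConvexBody E) : Prop :=
  ContDiffOn ℝ 2 (supportFunction (K : Set E)) {0}ᶜ ∧
    IsC1DiffeoOnImage (gradient (supportFunction (K : Set E))) (Metric.sphere 0 1)

/-- The fiber `K_x = {y ∈ W : x + y ∈ K}` over `x ∈ V`, where `W = Vᗮ`. -/
def fiber (V : Submodule ℝ E) (K : ConvexBody E) (x : V) : Set Vᗮ :=
  {y : Vᗮ | (x : E) + (y : E) ∈ K}

/-- The image `π(K)` under the orthogonal projection `π : E → V`. -/
def projBody (V : Submodule ℝ E) (K : ConvexBody E) : Set V :=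
  V.orthogonalProjectionOnto '' (K : Set E)

/-- The fiber body `Σ_π K ⊆ W = Vᗮ`: all integrals over `π(K)`, for the Lebesgue measure of the
Euclidean space `V`, of the Borel measurable sections `γ : π(K) → W`, `γ(x) ∈ K_x`.
(As `π(K)` is compact, measurable maps on `π(K)` are the restrictions of measurable maps on
`V`.) -/
def fiberBody [MeasurableSpace E] [BorelSpace E] (V : Submodule ℝ E) (K : ConvexBody E) :
    Set Vᗮ :=
  {y : Vᗮ | ∃ γ : V → Vᗮ, Measurable γ ∧ (∀ x ∈ projBody V K, γ x ∈ fiber V K x) ∧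
    y = ∫ x in projBody V K, γ x}

/-- The map `ψ_u : V → V`, `ψ_u(ξ) = π(∇h_K(u + ξ))`. -/
def psi (V : Submodule ℝ E) (K : ConvexBody E) (u : Vᗮ) (ξ : V) : V :=
  V.orthogonalProjectionOnto (gradient (supportFunction (K : Set E)) ((u : E) + (ξ : E)))

/-- The Jacobian `J_{ψ_u}(ξ)`: the determinant of the differential of `ψ_u` at `ξ`. -/
def jacPsi (V : Submodule ℝ E) (K : ConvexBody E) (u : Vᗮ) (ξ : V) : ℝ :=
  (fderiv ℝ (psi V K u) ξ).det

end

/-! Fix `u ≠ 0` in `W`. Maximizing `⟪u, ·⟫` over the fiber body is a fiberwise problem: choose the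
`u`-highest point of each `K_x`. These points form `upperBoundary`, the compact set of points of `K`
with an outer normal in `ℝ≥0 u + V`. There `π` is injective (`injOn_upperBoundary`) and onto `π(K)`
(`exists_mem_upperBoundary`), so inverting it gives the Borel section `upperSection`, whose integral
attains the maximum.

The points `∇h_K(u + ξ)` lie in `upperBoundary`, and `ψ_u` is their projection. It is injective, has
nonnegative Jacobian by monotonicity, and misses only frontier points of the convex set `π(K)`, a
null set. Changing variables along `ψ_u` turns integrals over `π(K)` into integrals over `V`.

For the gradient, the fiberwise maximizer is unique, hence continuous in `u`, and so is its integral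
by dominated convergence. A support function is differentiable where its maximizer varies
continuously. -/

/-! ### Support functions of curved bodies -/

section SupportFunction

variable {E : Type*} [NormedAddCommGroup E] [InnerProductSpace ℝ E]

theorem ConvexBody.bddAbove_inner (K : ConvexBody E) (x : E) :
    BddAbove ((fun z : E => inner ℝ x z) '' (K : Set E)) :=
  (K.isCompact.image (by fun_prop)).bddAbove

theorem ConvexBody.inner_le_supportFunction (K : ConvexBody E) (x : E) {z : E} (hz : z ∈ K) :
    inner ℝ x z ≤ supportFunction (K : Set E) x :=
  le_csSup (K.bddAbove_inner x) ⟨z, hz, rfl⟩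

theorem ConvexBody.exists_inner_eq_supportFunction (K : ConvexBody E) (x : E) :
    ∃ z ∈ K, inner ℝ x z = supportFunction (K : Set E) x := by
  have := (K.isCompact.image (f := fun z : E => inner ℝ x z) (by fun_prop)).sSup_mem
    (K.nonempty.image _)
  exact this

theorem ConvexBody.exists_norm_le (K : ConvexBody E) : ∃ R, 0 ≤ R ∧ ∀ z ∈ K, ‖z‖ ≤ R := by
  obtain ⟨R, hR⟩ := K.isBounded.exists_norm_le
  exact ⟨max R 0, le_max_right _ _, fun z hz => (hR z hz).trans (le_max_left _ _)⟩

variable [FiniteDimensional ℝ E] {K : ConvexBody E}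

theorem IsCurved.contDiffAt (hK : IsCurved K) {x : E} (hx : x ≠ 0) :
    ContDiffAt ℝ 2 (supportFunction (K : Set E)) x :=
  hK.1.contDiffAt (isOpen_compl_singleton.mem_nhds hx)

theorem IsCurved.hasGradientAt (hK : IsCurved K) {x : E} (hx : x ≠ 0) :
    HasGradientAt (supportFunction (K : Set E)) (gradient (supportFunction (K : Set E)) x) x :=
  ((hK.contDiffAt hx).differentiableAt (by norm_num)).hasGradientAt

theorem IsCurved.contDiffAt_gradient (hK : IsCurved K) {x : E} (hx : x ≠ 0) :
    ContDiffAt ℝ 1 (gradient (supportFunction (K : Set E))) x := by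
  have h1 : ContDiffAt ℝ 1 (fderiv ℝ (supportFunction (K : Set E))) x :=
    (hK.contDiffAt hx).fderiv_right (by norm_num)
  exact (InnerProductSpace.toDual ℝ E).symm.toContinuousLinearEquiv.contDiff.contDiffAt.comp x h1

/-- The maximizer over a curved body of a nonzero linear functional is the gradient of the
support function. -/
theorem IsCurved.eq_gradient (hK : IsCurved K) {x z : E} (hx : x ≠ 0) (hz : z ∈ K)
    (h : supportFunction (K : Set E) x ≤ inner ℝ x z) :
    z = gradient (supportFunction (K : Set E)) x := by
  have hmin : IsLocalMin (fun w => supportFunction (K : Set E) w - inner ℝ w z) x := by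
    refine Filter.Eventually.of_forall fun w => ?_
    have := K.inner_le_supportFunction w hz
    dsimp only
    linarith
  have hd := (hK.hasGradientAt hx).hasFDerivAt
  have hd2 : HasFDerivAt (fun w : E => inner ℝ w z) (innerSL ℝ z) x := by
    have := (innerSL ℝ z).hasFDerivAt (x := x)
    refine this.congr_of_eventuallyEq (Filter.Eventually.of_forall fun w => ?_)
    simp [real_inner_comm]
  have h0 := hmin.hasFDerivAt_eq_zero (hd.sub hd2)
  refine ext_inner_right ℝ fun v => ?_
  have : (inner ℝ (gradient (supportFunction (K : Set E)) x) v : ℝ) - inner ℝ z v = 0 :=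
    congrArg (fun L => L v) h0
  linarith

theorem IsCurved.gradient_mem (hK : IsCurved K) {x : E} (hx : x ≠ 0) :
    gradient (supportFunction (K : Set E)) x ∈ K := by
  obtain ⟨z, hz, h⟩ := K.exists_inner_eq_supportFunction x
  rwa [← hK.eq_gradient hx hz h.ge]

theorem IsCurved.inner_gradient (hK : IsCurved K) {x : E} (hx : x ≠ 0) :
    inner ℝ x (gradient (supportFunction (K : Set E)) x) = supportFunction (K : Set E) x := by
  obtain ⟨z, hz, h⟩ := K.exists_inner_eq_supportFunction x
  rwa [← hK.eq_gradient hx hz h.ge]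

theorem IsCurved.inner_le_inner_gradient (hK : IsCurved K) {x z : E} (hx : x ≠ 0) (hz : z ∈ K) :
    inner ℝ x z ≤ inner ℝ x (gradient (supportFunction (K : Set E)) x) :=
  (K.inner_le_supportFunction x hz).trans (hK.inner_gradient hx).ge

theorem IsCurved.eq_gradient_of_inner_le (hK : IsCurved K) {x z : E} (hx : x ≠ 0) (hz : z ∈ K)
    (h : inner ℝ x (gradient (supportFunction (K : Set E)) x) ≤ inner ℝ x z) :
    z = gradient (supportFunction (K : Set E)) x :=
  hK.eq_gradient hx hz ((hK.inner_gradient hx).symm.trans_le h)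

theorem IsCurved.gradient_smul (hK : IsCurved K) {x : E} (hx : x ≠ 0) {c : ℝ} (hc : 0 < c) :
    gradient (supportFunction (K : Set E)) (c • x) =
      gradient (supportFunction (K : Set E)) x := by
  have hcx : c • x ≠ 0 := smul_ne_zero hc.ne' hx
  refine hK.eq_gradient_of_inner_le hx (hK.gradient_mem hcx) ?_
  have := hK.inner_le_inner_gradient hcx (hK.gradient_mem hx)
  rw [real_inner_smul_left, real_inner_smul_left] at this
  exact le_of_mul_le_mul_left this hc

/-- The diffeomorphism hypothesis enters only here, through the left inverse of the gradient on the
sphere; homogeneity of degree zero reduces to unit vectors. -/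
theorem IsCurved.normalize_eq_of_gradient_eq (hK : IsCurved K) {x y : E} (hx : x ≠ 0) (hy : y ≠ 0)
    (h : gradient (supportFunction (K : Set E)) x = gradient (supportFunction (K : Set E)) y) :
    ‖x‖⁻¹ • x = ‖y‖⁻¹ • y := by
  obtain ⟨-, g, hg, -⟩ := hK.2
  have key : ∀ {w : E}, w ≠ 0 → g (gradient (supportFunction (K : Set E)) w) = ‖w‖⁻¹ • w := by
    intro w hw
    rw [← hK.gradient_smul hw (inv_pos.2 (norm_pos_iff.2 hw))]
    exact hg (by simp [norm_smul, hw])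
  rw [← key hx, ← key hy, h]

end SupportFunction

/-! ### The upper boundary and the map `ψ_u` -/

section Fiber

variable {E : Type*} [NormedAddCommGroup E] [InnerProductSpace ℝ E]
  {V : Submodule ℝ E}

theorem add_coe_ne_zero {u : Vᗮ} (hu : u ≠ 0) (ξ : V) : (u : E) + (ξ : E) ≠ 0 := by
  intro h
  have h1 : (inner ℝ (u : E) ((u : E) + (ξ : E)) : ℝ) = 0 := by rw [h, inner_zero_right]
  rw [inner_add_right, Submodule.inner_left_of_mem_orthogonal ξ.2 u.2, add_zero,
    inner_self_eq_zero] at h1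
  exact hu (by exact_mod_cast h1)

/-- The unit vectors of the closed half-space `ℝ≥0 u + V`. -/
def halfSphere (V : Submodule ℝ E) (u : Vᗮ) : Set E :=
  {d | ‖d‖ = 1 ∧ ∃ a : ℝ, 0 ≤ a ∧ ∃ ξ : V, d = a • (u : E) + (ξ : E)}

theorem ne_zero_of_mem_halfSphere {u : Vᗮ} {d : E} (hd : d ∈ halfSphere V u) : d ≠ 0 := by
  rw [← norm_ne_zero_iff, hd.1]
  exact one_ne_zero

variable [FiniteDimensional ℝ E] {K : ConvexBody E}

theorem inner_coe_eq_of_proj_eq {z z' : E}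
    (h : V.orthogonalProjectionOnto z' = V.orthogonalProjectionOnto z) (ξ : V) :
    (inner ℝ (ξ : E) z' : ℝ) = inner ℝ (ξ : E) z := by
  rw [← Submodule.inner_orthogonalProjectionOnto_eq_of_mem_left,
    ← Submodule.inner_orthogonalProjectionOnto_eq_of_mem_left, h]

theorem proj_add_coe (x : V) (y : Vᗮ) : V.orthogonalProjectionOnto ((x : E) + (y : E)) = x := by
  rw [map_add, Submodule.orthogonalProjectionOnto_apply_of_mem_orthogonal y.2, add_zero,
    Submodule.orthogonalProjectionOnto_mem_subspace_eq_self]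

theorem proj_orthogonal_add_coe (x : V) (y : Vᗮ) :
    Vᗮ.orthogonalProjectionOnto ((x : E) + (y : E)) = y := by
  rw [map_add, Submodule.orthogonalProjectionOnto_apply_of_mem_orthogonal (by simp), zero_add,
    Submodule.orthogonalProjectionOnto_mem_subspace_eq_self]

theorem proj_coe_add_proj_orthogonal_coe (z : E) :
    (V.orthogonalProjectionOnto z : E) + (Vᗮ.orthogonalProjectionOnto z : E) = z :=
  Submodule.starProjection_add_starProjection_orthogonal (K := V) z

/-- The points of `K` at which the outer normal lies in `ℝ≥0 u + V`. -/
def upperBoundary (V : Submodule ℝ E) (K : ConvexBody E) (u : Vᗮ) : Set E :=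
  gradient (supportFunction (K : Set E)) '' halfSphere V u

theorem isCompact_halfSphere {u : Vᗮ} (hu : u ≠ 0) : IsCompact (halfSphere V u) := by
  have hu2 : ‖(u : E)‖ ^ 2 ≠ 0 := by simpa using hu
  -- As `u ⟂ V`, the coefficient `a` is `⟪u, d⟫ / ‖u‖²`, so membership becomes a closed condition.
  have : halfSphere V u = Metric.sphere (0 : E) 1 ∩ {d : E | 0 ≤ (inner ℝ (u : E) d : ℝ) ∧
      V.orthogonalProjectionOnto d + ((inner ℝ (u : E) d : ℝ) / ‖(u : E)‖ ^ 2) • (u : E) = d} := by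
    ext d
    simp only [halfSphere, Set.mem_ofPred_eq, Set.mem_inter_iff, mem_sphere_iff_norm, sub_zero]
    refine and_congr_right fun _ => ⟨?_, ?_⟩
    · rintro ⟨a, ha, ξ, rfl⟩
      have h1 : (inner ℝ (u : E) (a • (u : E) + (ξ : E)) : ℝ) = a * ‖(u : E)‖ ^ 2 := by
        rw [inner_add_right, Submodule.inner_left_of_mem_orthogonal ξ.2 u.2, add_zero,
          real_inner_smul_right, real_inner_self_eq_norm_sq]
      refine ⟨by rw [h1]; positivity, ?_⟩
      rw [h1, mul_div_cancel_right₀ _ hu2, add_comm (a • (u : E)), ← Submodule.coe_smul,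
        proj_add_coe]
    · rintro ⟨h1, h2⟩
      exact ⟨inner ℝ (u : E) d / ‖(u : E)‖ ^ 2, by positivity, V.orthogonalProjectionOnto d,
        by rw [add_comm, h2]⟩
  rw [this]
  refine (isCompact_sphere _ _).inter_right (IsClosed.and ?_ ?_)
  · exact isClosed_le (by fun_prop) (by fun_prop)
  · exact isClosed_eq (by fun_prop) (by fun_prop)

theorem IsCurved.isCompact_upperBoundary (hK : IsCurved K) {u : Vᗮ} (hu : u ≠ 0) :
    IsCompact (upperBoundary V K u) :=
  (isCompact_halfSphere hu).image_of_continuousOn fun _ hd =>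
    (hK.contDiffAt_gradient (ne_zero_of_mem_halfSphere hd)).continuousAt.continuousWithinAt

theorem IsCurved.gradient_mem_upperBoundary (hK : IsCurved K) {u : Vᗮ} {a : ℝ} (ha : 0 ≤ a) (ξ : V)
    (h : a • (u : E) + (ξ : E) ≠ 0) :
    gradient (supportFunction (K : Set E)) (a • (u : E) + (ξ : E)) ∈ upperBoundary V K u := by
  have hn := norm_pos_iff.2 h
  rw [← hK.gradient_smul h (inv_pos.2 hn)]
  refine ⟨_, ⟨by rw [norm_smul, norm_inv, norm_norm, inv_mul_cancel₀ hn.ne'],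
    ‖a • (u : E) + (ξ : E)‖⁻¹ * a, by positivity, ‖a • (u : E) + (ξ : E)‖⁻¹ • ξ, ?_⟩, rfl⟩
  rw [smul_add, smul_smul, Submodule.coe_smul]

theorem IsCurved.upperBoundary_subset (hK : IsCurved K) (u : Vᗮ) :
    upperBoundary V K u ⊆ K := by
  rintro _ ⟨d, hd, rfl⟩
  exact hK.gradient_mem (ne_zero_of_mem_halfSphere hd)

/-- Let `a • u + ξ` be a normal at `z`. Its `ξ` part does not distinguish points with the same
projection, and `a ≥ 0`, so `z'` also maximizes this functional over `K`; the maximizer is unique.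
The case `a = 0` is included. -/
theorem IsCurved.eq_of_mem_upperBoundary (hK : IsCurved K) {u : Vᗮ} {z z' : E}
    (hz : z ∈ upperBoundary V K u) (hz' : z' ∈ K)
    (h : V.orthogonalProjectionOnto z' = V.orthogonalProjectionOnto z)
    (hle : (inner ℝ (u : E) z : ℝ) ≤ inner ℝ (u : E) z') : z' = z := by
  obtain ⟨d, hd, rfl⟩ := hz
  have hd0 := ne_zero_of_mem_halfSphere hd
  obtain ⟨-, a, ha, ξ, hdξ⟩ := hd
  refine hK.eq_gradient_of_inner_le hd0 hz' ?_
  have h1 := inner_coe_eq_of_proj_eq h ξ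
  nth_rewrite 1 [hdξ]
  nth_rewrite 2 [hdξ]
  rw [inner_add_left, inner_add_left, h1, real_inner_smul_left, real_inner_smul_left]
  gcongr

theorem IsCurved.inner_le_of_mem_upperBoundary (hK : IsCurved K) {u : Vᗮ} {z z' : E}
    (hz : z ∈ upperBoundary V K u) (hz' : z' ∈ K)
    (h : V.orthogonalProjectionOnto z' = V.orthogonalProjectionOnto z) :
    (inner ℝ (u : E) z' : ℝ) ≤ inner ℝ (u : E) z := by
  by_contra! hlt
  exact hlt.ne' (by rw [hK.eq_of_mem_upperBoundary hz hz' h hlt.le])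

theorem IsCurved.injOn_upperBoundary (hK : IsCurved K) (u : Vᗮ) :
    Set.InjOn V.orthogonalProjectionOnto (upperBoundary V K u) := by
  intro z hz z' hz' h
  exact hK.eq_of_mem_upperBoundary hz' (hK.upperBoundary_subset u hz) h
    (hK.inner_le_of_mem_upperBoundary hz (hK.upperBoundary_subset u hz') h.symm)

/-- A point of the projection that is not supported by any direction of `V` lies in the range of
`psi V K u`. -/
theorem IsCurved.exists_psi_eq (hK : IsCurved K) {u : Vᗮ} (hu : u ≠ 0) {x : V}
    (hx : ∀ ξ : V, ξ ≠ 0 → inner ℝ ξ x < supportFunction (K : Set E) (ξ : E)) :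
    ∃ ξ : V, psi V K u ξ = x := by
  obtain ⟨R, hR0, hR⟩ := K.exists_norm_le
  -- Compactness of the unit sphere of `V` makes the strict gap uniform; `ε` is then the growth rate
  -- of the function minimized below.
  obtain ⟨ε, hε, hεle⟩ : ∃ ε : ℝ, 0 < ε ∧ ∀ e ∈ Metric.sphere (0 : V) 1,
      ε ≤ supportFunction (K : Set E) (e : E) - inner ℝ e x := by
    refine (isCompact_sphere (0 : V) 1).exists_forall_le' ?_ fun e he => ?_
    · refine ContinuousOn.sub (fun e he => ?_) (by fun_prop)
      have he0 : (e : E) ≠ 0 := by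
        simpa using ne_zero_of_mem_unit_sphere (⟨e, he⟩ : Metric.sphere (0 : V) 1)
      exact ((hK.contDiffAt he0).continuousAt.comp
        continuous_subtype_val.continuousAt).continuousWithinAt
    · exact sub_pos.2 (hx e (ne_zero_of_mem_unit_sphere (⟨e, he⟩ : Metric.sphere (0 : V) 1)))
  have hcont : Continuous fun ξ : V => supportFunction (K : Set E) ((u : E) + ξ) - inner ℝ ξ x := by
    refine Continuous.sub (continuous_iff_continuousAt.2 fun ξ => ?_) (by fun_prop)
    exact ContinuousAt.comp (f := fun ξ : V => (u : E) + ξ)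
      (hK.contDiffAt (add_coe_ne_zero hu ξ)).continuousAt (by fun_prop)
  have hbound : ∀ ξ : V, ε * ‖ξ‖ - ‖u‖ * R ≤
      supportFunction (K : Set E) ((u : E) + ξ) - inner ℝ ξ x := by
    intro ξ
    have hlow : ∀ z ∈ K, -(‖u‖ * R) + inner ℝ (ξ : E) z ≤
        supportFunction (K : Set E) ((u : E) + ξ) := by
      intro z hz
      refine le_trans ?_ (K.inner_le_supportFunction _ hz)
      rw [inner_add_left]
      gcongr
      refine (neg_le_neg ?_).trans (neg_abs_le _)
      exact (abs_real_inner_le_norm _ _).trans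
        (mul_le_mul_of_nonneg_left (hR z hz) (norm_nonneg _))
    rcases eq_or_ne ξ 0 with rfl | hξ
    · obtain ⟨z, hz⟩ := K.nonempty
      have := hlow z hz
      simp at this ⊢
      linarith
    · have hn := norm_pos_iff.2 hξ
      obtain ⟨z, hz, hzeq⟩ := K.exists_inner_eq_supportFunction ((‖ξ‖⁻¹ • ξ : V) : E)
      have h1 := hεle (‖ξ‖⁻¹ • ξ) (by simp [norm_smul, hξ])
      rw [← hzeq, Submodule.coe_smul, real_inner_smul_left, real_inner_smul_left, ← mul_sub,
        ← div_eq_inv_mul, le_div_iff₀ hn] at h1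
      have := hlow z hz
      linarith
  have hlim : Filter.Tendsto
      (fun ξ : V => supportFunction (K : Set E) ((u : E) + ξ) - inner ℝ ξ x)
      (Filter.cocompact V) Filter.atTop :=
    Filter.tendsto_atTop_mono hbound (Filter.tendsto_atTop_add_const_right _ _
      ((tendsto_norm_cocompact_atTop (E := V)).const_mul_atTop hε))
  -- By coercivity `ξ ↦ h_K(u + ξ) - ⟪ξ, x⟫` has a minimizer; its critical point equation is `ψ_u(ξ)
  -- = x`.
  obtain ⟨ξ, hξ⟩ := hcont.exists_forall_le hlim
  refine ⟨ξ, ?_⟩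
  have hd : HasFDerivAt (fun ξ : V => supportFunction (K : Set E) ((u : E) + ξ)) _ ξ :=
    HasFDerivAt.comp (f := fun ξ : V => (u : E) + ξ) ξ
      (hK.hasGradientAt (add_coe_ne_zero hu ξ)).hasFDerivAt
      (V.subtypeL.hasFDerivAt.const_add (u : E))
  have hd2 : HasFDerivAt (fun w : V => (inner ℝ w x : ℝ)) (innerSL ℝ x) ξ := by
    refine (innerSL ℝ x).hasFDerivAt.congr_of_eventuallyEq
      (Filter.Eventually.of_forall fun w => ?_)
    simp [real_inner_comm]
  have h0 := IsLocalMin.hasFDerivAt_eq_zero (Filter.Eventually.of_forall hξ) (hd.sub hd2)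
  refine ext_inner_right ℝ fun v => ?_
  have : (inner ℝ (gradient (supportFunction (K : Set E)) ((u : E) + ξ)) (v : E) : ℝ) -
    inner ℝ x v = 0 := congrArg (fun L => L v) h0
  rw [psi, Submodule.inner_orthogonalProjectionOnto_eq_of_mem_right]
  linarith

/-- Equal values force equal gradients, so `u + ξ` and `u + η` have the same direction; their common
`W`-component `u ≠ 0` makes them equal. -/
theorem IsCurved.psi_injective (hK : IsCurved K) {u : Vᗮ} (hu : u ≠ 0) :
    Function.Injective (psi V K u) := by
  intro ξ η h
  have hmem : ∀ ξ : V, gradient (supportFunction (K : Set E)) ((u : E) + ξ) ∈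
      upperBoundary V K u := fun ξ => by
    simpa using hK.gradient_mem_upperBoundary (u := u) zero_le_one ξ
      (by simpa using add_coe_ne_zero hu ξ)
  have h1 := hK.normalize_eq_of_gradient_eq (add_coe_ne_zero hu ξ) (add_coe_ne_zero hu η)
    (hK.injOn_upperBoundary u (hmem ξ) (hmem η) h)
  have h2 := congrArg Vᗮ.orthogonalProjectionOnto h1
  have h3 := congrArg V.orthogonalProjectionOnto h1
  rw [map_smul, map_smul, add_comm, add_comm (u : E), proj_orthogonal_add_coe,
    proj_orthogonal_add_coe] at h2
  rw [map_smul, map_smul, add_comm, add_comm (u : E), proj_add_coe, proj_add_coe] at h3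
  have h4 := smul_left_injective ℝ hu h2
  rw [h4] at h3
  refine smul_right_injective V (inv_ne_zero (norm_ne_zero_iff.2 ?_)) h3
  rw [add_comm]
  exact add_coe_ne_zero hu η

end Fiber

/-! ### Determinants of monotone maps -/

/-- On the segment from `A` to the identity the determinant ends at `1`. Were it negative at `A`, it
would vanish at some `s > 0`, and a kernel vector there contradicts `s ‖v‖² > 0`. -/
theorem ContinuousLinearMap.det_nonneg_of_inner_nonneg {F : Type*} [NormedAddCommGroup F]
    [InnerProductSpace ℝ F] [FiniteDimensional ℝ F] (A : F →L[ℝ] F)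
    (hA : ∀ v, 0 ≤ (inner ℝ (A v) v : ℝ)) : 0 ≤ A.det := by
  by_contra! hneg
  have hcont : Continuous fun s : ℝ =>
      ((1 - s) • A + s • ContinuousLinearMap.id ℝ F).det :=
    ContinuousLinearMap.continuous_det.comp (by fun_prop)
  obtain ⟨s, hs, h0⟩ : (0 : ℝ) ∈ (fun s : ℝ =>
      ((1 - s) • A + s • ContinuousLinearMap.id ℝ F).det) '' Set.Icc 0 1 := by
    refine intermediate_value_Icc zero_le_one hcont.continuousOn ⟨?_, ?_⟩
    · simpa using hneg.le
    · simp [ContinuousLinearMap.det]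
  have hs0 : 0 < s := by
    refine hs.1.lt_of_ne ?_
    rintro rfl
    simp [hneg.ne] at h0
  obtain ⟨v, hv, hv0⟩ := (Submodule.ne_bot_iff _).1 (LinearMap.bot_lt_ker_of_det_eq_zero h0).ne'
  have hv' : (1 - s) • A v + s • v = 0 := hv
  have h1 : (inner ℝ ((1 - s) • A v + s • v) v : ℝ) = 0 := by rw [hv', inner_zero_left]
  rw [inner_add_left, real_inner_smul_left, real_inner_smul_left] at h1
  have h2 : 0 < (inner ℝ v v : ℝ) := real_inner_self_pos.2 hv0
  have := mul_nonneg (sub_nonneg.2 hs.2) (hA v)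
  have := mul_pos hs0 h2
  linarith

/-- The differential of a monotone map is a nonnegative form. -/
theorem inner_fderiv_nonneg_of_monotone {F : Type*} [NormedAddCommGroup F]
    [InnerProductSpace ℝ F] {f : F → F} {f' : F →L[ℝ] F} {x : F} (hf : HasFDerivAt f f' x)
    (hmono : ∀ y, 0 ≤ (inner ℝ (f y - f x) (y - x) : ℝ)) (v : F) :
    0 ≤ (inner ℝ (f' v) v : ℝ) := by
  have hlim := (hf.hasLineDerivAt v).tendsto_slope_zero_right
  refine ge_of_tendsto (hlim.inner tendsto_const_nhds) ?_
  filter_upwards [self_mem_nhdsWithin] with t ht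
  have ht : (0 : ℝ) < t := ht
  have h := hmono (x + t • v)
  rw [add_sub_cancel_left, real_inner_smul_right] at h
  rw [real_inner_smul_left]
  exact mul_nonneg (inv_nonneg.2 ht.le) ((mul_nonneg_iff_of_pos_left ht).1 h)

/-! ### Change of variables along `ψ_u` -/

section ChangeOfVariables

variable {E : Type*} [NormedAddCommGroup E] [InnerProductSpace ℝ E] [FiniteDimensional ℝ E]
  {V : Submodule ℝ E} {K : ConvexBody E}

theorem isCompact_projBody (V : Submodule ℝ E) (K : ConvexBody E) : IsCompact (projBody V K) :=
  K.isCompact.image V.orthogonalProjectionOnto.continuous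

theorem convex_projBody (V : Submodule ℝ E) (K : ConvexBody E) : Convex ℝ (projBody V K) :=
  K.convex.linear_image V.orthogonalProjectionOnto.toLinearMap

theorem IsCurved.psi_mem_projBody (hK : IsCurved K) {u : Vᗮ} (hu : u ≠ 0) (ξ : V) :
    psi V K u ξ ∈ projBody V K :=
  ⟨_, hK.gradient_mem (add_coe_ne_zero hu ξ), rfl⟩

theorem IsCurved.exists_le_inner_of_notMem_range_psi (hK : IsCurved K) {u : Vᗮ} (hu : u ≠ 0) {x : V}
    (hx : x ∉ Set.range (psi V K u)) :
    ∃ ξ : V, ξ ≠ 0 ∧ supportFunction (K : Set E) (ξ : E) ≤ inner ℝ ξ x := by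
  contrapose! hx
  exact hK.exists_psi_eq hu hx

theorem inner_le_supportFunction_of_mem_projBody {x : V} (hx : x ∈ projBody V K) (ξ : V) :
    inner ℝ ξ x ≤ supportFunction (K : Set E) (ξ : E) := by
  obtain ⟨z, hz, rfl⟩ := hx
  rw [Submodule.inner_orthogonalProjectionOnto_eq_of_mem_left]
  exact K.inner_le_supportFunction _ hz

/-- A missed point is supported by some nonzero `ξ` in `V`, so any step in the direction `ξ` leaves
`π(K)`. -/
theorem IsCurved.projBody_diff_range_subset (hK : IsCurved K) {u : Vᗮ} (hu : u ≠ 0) :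
    projBody V K \ Set.range (psi V K u) ⊆ frontier (projBody V K) := by
  rintro x ⟨hx, hxr⟩
  refine ⟨subset_closure hx, fun hxi => ?_⟩
  obtain ⟨ξ, hξ, hle⟩ := hK.exists_le_inner_of_notMem_range_psi hu hxr
  have hlim : Filter.Tendsto (fun t : ℝ => x + t • ξ) (nhdsWithin 0 (Set.Ioi 0)) (nhds x) := by
    have : Continuous fun t : ℝ => x + t • ξ := by fun_prop
    simpa using (this.tendsto 0).mono_left nhdsWithin_le_nhds
  obtain ⟨t, ht, ht0⟩ := ((hlim.eventually (mem_interior_iff_mem_nhds.1 hxi)).and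
    self_mem_nhdsWithin).exists
  have ht0 : (0 : ℝ) < t := ht0
  have h1 := inner_le_supportFunction_of_mem_projBody ht ξ
  rw [inner_add_right, real_inner_smul_right] at h1
  have := mul_pos ht0 (real_inner_self_pos.2 hξ)
  linarith

theorem IsCurved.exists_mem_upperBoundary (hK : IsCurved K) {u : Vᗮ} (hu : u ≠ 0) {x : V}
    (hx : x ∈ projBody V K) : ∃ z ∈ upperBoundary V K u, V.orthogonalProjectionOnto z = x := by
  by_cases hxr : x ∈ Set.range (psi V K u)
  · obtain ⟨ξ, rfl⟩ := hxr
    refine ⟨_, ?_, rfl⟩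
    simpa using hK.gradient_mem_upperBoundary (u := u) zero_le_one ξ
      (by simpa using add_coe_ne_zero hu ξ)
  -- Missed points have a normal in `V` itself, the case `a = 0` of the half-sphere.
  · obtain ⟨ξ, hξ, hle⟩ := hK.exists_le_inner_of_notMem_range_psi hu hxr
    obtain ⟨z, hz, rfl⟩ := hx
    refine ⟨z, ?_, rfl⟩
    rw [Submodule.inner_orthogonalProjectionOnto_eq_of_mem_left] at hle
    have hξ' : (ξ : E) ≠ 0 := by simpa using hξ
    rw [hK.eq_gradient hξ' hz hle]
    simpa using hK.gradient_mem_upperBoundary (u := u) le_rfl ξ (by simpa using hξ)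

theorem IsCurved.differentiableAt_psi (hK : IsCurved K) {u : Vᗮ} (hu : u ≠ 0) (ξ : V) :
    DifferentiableAt ℝ (psi V K u) ξ := by
  have h1 := (hK.contDiffAt_gradient (add_coe_ne_zero hu ξ)).differentiableAt (by norm_num)
  have h2 : DifferentiableAt ℝ (fun ξ : V => (u : E) + (ξ : E)) ξ :=
    (V.subtypeL.differentiableAt).const_add (u : E)
  exact V.orthogonalProjectionOnto.differentiableAt.comp ξ
    (DifferentiableAt.comp (g := gradient (supportFunction (K : Set E))) ξ h1 h2)

/-- Add the maximality inequalities for the normals `u + ξ` and `u + η`; the `u` terms cancel. -/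
theorem IsCurved.inner_psi_sub_nonneg (hK : IsCurved K) {u : Vᗮ} (hu : u ≠ 0) (ξ η : V) :
    0 ≤ (inner ℝ (psi V K u η - psi V K u ξ) (η - ξ) : ℝ) := by
  have h1 := hK.inner_le_inner_gradient (add_coe_ne_zero hu ξ)
    (hK.gradient_mem (add_coe_ne_zero hu η))
  have h2 := hK.inner_le_inner_gradient (add_coe_ne_zero hu η)
    (hK.gradient_mem (add_coe_ne_zero hu ξ))
  rw [psi, psi, ← map_sub, Submodule.inner_orthogonalProjectionOnto_eq_of_mem_right,
    real_inner_comm, Submodule.coe_sub, inner_sub_left, inner_sub_right, inner_sub_right]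
  rw [inner_add_left, inner_add_left] at h1 h2
  linarith

theorem IsCurved.jacPsi_nonneg (hK : IsCurved K) {u : Vᗮ} (hu : u ≠ 0) (ξ : V) :
    0 ≤ jacPsi V K u ξ :=
  ContinuousLinearMap.det_nonneg_of_inner_nonneg _
    (inner_fderiv_nonneg_of_monotone (hK.differentiableAt_psi hu ξ).hasFDerivAt
      (hK.inner_psi_sub_nonneg hu ξ))

variable [MeasurableSpace E] [BorelSpace E] {G : Type*} [NormedAddCommGroup G] [NormedSpace ℝ G]

theorem IsCurved.range_psi_ae_eq (hK : IsCurved K) {u : Vᗮ} (hu : u ≠ 0) :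
    Set.range (psi V K u) =ᵐ[volume] projBody V K := by
  refine Filter.EventuallyLE.antisymm (LE.le.eventuallyLE ?_) ?_
  · rintro _ ⟨ξ, rfl⟩
    exact hK.psi_mem_projBody hu ξ
  · exact ae_le_set.2 (measure_mono_null (hK.projBody_diff_range_subset hu)
      ((convex_projBody V K).addHaar_frontier volume))

theorem IsCurved.setIntegral_projBody (hK : IsCurved K) {u : Vᗮ} (hu : u ≠ 0) (g : V → G) :
    ∫ x in projBody V K, g x = ∫ ξ, jacPsi V K u ξ • g (psi V K u ξ) := by
  rw [← setIntegral_congr_set (hK.range_psi_ae_eq hu), ← Set.image_univ,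
    integral_image_eq_integral_abs_det_fderiv_smul volume MeasurableSet.univ
      (fun ξ _ => (hK.differentiableAt_psi hu ξ).hasFDerivAt.hasFDerivWithinAt)
      (hK.psi_injective hu).injOn, setIntegral_univ]
  refine integral_congr_ae (.of_forall fun ξ => ?_)
  dsimp only
  rw [← jacPsi, abs_of_nonneg (hK.jacPsi_nonneg hu ξ)]

theorem IsCurved.integrable_jacPsi_smul (hK : IsCurved K) {u : Vᗮ} (hu : u ≠ 0) {g : V → G}
    (hg : IntegrableOn g (projBody V K)) :
    Integrable fun ξ => jacPsi V K u ξ • g (psi V K u ξ) := by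
  rw [← integrableOn_congr_set_ae (hK.range_psi_ae_eq hu), ← Set.image_univ,
    integrableOn_image_iff_integrableOn_abs_det_fderiv_smul volume MeasurableSet.univ
      (fun ξ _ => (hK.differentiableAt_psi hu ξ).hasFDerivAt.hasFDerivWithinAt)
      (hK.psi_injective hu).injOn, integrableOn_univ] at hg
  refine hg.congr (.of_forall fun ξ => ?_)
  dsimp only
  rw [← jacPsi, abs_of_nonneg (hK.jacPsi_nonneg hu ξ)]

end ChangeOfVariables

/-! ### The maximizing section and its integral -/

section Section

variable {E : Type*} [NormedAddCommGroup E] [InnerProductSpace ℝ E] {V : Submodule ℝ E}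

theorem inner_add_coe (u : Vᗮ) (x : V) (y : Vᗮ) :
    (inner ℝ (u : E) ((x : E) + (y : E)) : ℝ) = inner ℝ u y := by
  rw [inner_add_right, Submodule.inner_left_of_mem_orthogonal x.2 u.2, zero_add,
    Submodule.coe_inner]

variable [FiniteDimensional ℝ E] {K : ConvexBody E}

theorem isCompact_fiber (V : Submodule ℝ E) (K : ConvexBody E) (x : V) :
    IsCompact (fiber V K x) := by
  have hemb : Topology.IsClosedEmbedding fun y : Vᗮ => (x : E) + (y : E) :=
    (Homeomorph.addLeft (x : E)).isClosedEmbedding.comp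
      Vᗮ.closed_of_finiteDimensional.isClosedEmbedding_subtypeVal
  exact hemb.isCompact_preimage K.isCompact

theorem ConvexBody.exists_norm_fiber_le (V : Submodule ℝ E) (K : ConvexBody E) :
    ∃ R, ∀ x, ∀ y ∈ fiber V K x, ‖y‖ ≤ R := by
  obtain ⟨R, -, hR⟩ := K.exists_norm_le
  refine ⟨R, fun x y hy => ?_⟩
  rw [← proj_orthogonal_add_coe x y]
  exact (Submodule.norm_orthogonalProjectionOnto_apply_le _ _).trans (hR _ hy)

variable [MeasurableSpace E] [BorelSpace E]

/-- A Borel section of `K` over its projection that maximizes `u` in each fiber. -/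
theorem IsCurved.exists_measurable_upperSection (hK : IsCurved K) {u : Vᗮ} (hu : u ≠ 0) :
    ∃ γ : V → Vᗮ, Measurable γ ∧
      ∀ x ∈ projBody V K, (x : E) + (γ x : E) ∈ upperBoundary V K u := by
  have hcomp := hK.isCompact_upperBoundary (V := V) hu
  have : CompactSpace (upperBoundary V K u) := isCompact_iff_compactSpace.1 hcomp
  -- A continuous injection of a compact space is a closed embedding, so its inverse is Borel and
  -- extends to `V`.
  have hemb : MeasurableEmbedding fun z : upperBoundary V K u =>
      V.orthogonalProjectionOnto (z : E) := by
    refine (Continuous.isClosedEmbedding (by fun_prop) fun z z' h => ?_).measurableEmbedding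
    exact Subtype.ext (hK.injOn_upperBoundary u z.2 z'.2 h)
  obtain ⟨γ, hγ, hγeq⟩ := hemb.exists_measurable_extend
    (g := fun z : upperBoundary V K u => Vᗮ.orthogonalProjectionOnto (z : E))
    (Continuous.measurable (by fun_prop)) fun _ => inferInstance
  refine ⟨γ, hγ, fun x hx => ?_⟩
  obtain ⟨z, hz, rfl⟩ := hK.exists_mem_upperBoundary hu hx
  have h1 := congrFun hγeq ⟨z, hz⟩
  simp only [Function.comp_apply] at h1
  rwa [h1, proj_coe_add_proj_orthogonal_coe]

open Classical in
/-- The section of `K` over its projection that maximizes `u` in each fiber (zero if there is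
no Borel one). -/
noncomputable def upperSection (V : Submodule ℝ E) (K : ConvexBody E) (u : Vᗮ) : V → Vᗮ :=
  if h : ∃ γ : V → Vᗮ, Measurable γ ∧
    ∀ x ∈ projBody V K, (x : E) + (γ x : E) ∈ upperBoundary V K u then h.choose else 0

theorem IsCurved.measurable_upperSection (hK : IsCurved K) {u : Vᗮ} (hu : u ≠ 0) :
    Measurable (upperSection V K u) := by
  have h := hK.exists_measurable_upperSection hu
  rw [upperSection, dif_pos h]
  exact h.choose_spec.1

theorem IsCurved.upperSection_mem_upperBoundary (hK : IsCurved K) {u : Vᗮ} (hu : u ≠ 0) {x : V}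
    (hx : x ∈ projBody V K) : (x : E) + (upperSection V K u x : E) ∈ upperBoundary V K u := by
  have h := hK.exists_measurable_upperSection hu
  rw [upperSection, dif_pos h]
  exact h.choose_spec.2 x hx

theorem IsCurved.upperSection_mem_fiber (hK : IsCurved K) {u : Vᗮ} (hu : u ≠ 0) {x : V}
    (hx : x ∈ projBody V K) : upperSection V K u x ∈ fiber V K x :=
  hK.upperBoundary_subset u (hK.upperSection_mem_upperBoundary hu hx)

theorem IsCurved.upperSection_psi (hK : IsCurved K) {u : Vᗮ} (hu : u ≠ 0) (ξ : V) :
    upperSection V K u (psi V K u ξ) =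
      Vᗮ.orthogonalProjectionOnto (gradient (supportFunction (K : Set E)) ((u : E) + ξ)) := by
  have h1 : gradient (supportFunction (K : Set E)) ((u : E) + ξ) ∈ upperBoundary V K u := by
    simpa using hK.gradient_mem_upperBoundary (u := u) zero_le_one ξ
      (by simpa using add_coe_ne_zero hu ξ)
  rw [← hK.injOn_upperBoundary u (hK.upperSection_mem_upperBoundary hu
    (hK.psi_mem_projBody hu ξ)) h1 (by rw [proj_add_coe, psi]), proj_orthogonal_add_coe]

theorem IsCurved.inner_le_inner_upperSection (hK : IsCurved K) {u : Vᗮ} (hu : u ≠ 0) {x : V}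
    (hx : x ∈ projBody V K) {y : Vᗮ} (hy : y ∈ fiber V K x) :
    (inner ℝ u y : ℝ) ≤ inner ℝ u (upperSection V K u x) := by
  rw [← inner_add_coe u x, ← inner_add_coe u x]
  exact hK.inner_le_of_mem_upperBoundary (hK.upperSection_mem_upperBoundary hu hx) hy
    (by rw [proj_add_coe, proj_add_coe])

theorem IsCurved.eq_upperSection (hK : IsCurved K) {u : Vᗮ} (hu : u ≠ 0) {x : V}
    (hx : x ∈ projBody V K) {y : Vᗮ} (hy : y ∈ fiber V K x)
    (hle : (inner ℝ u (upperSection V K u x) : ℝ) ≤ inner ℝ u y) :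
    y = upperSection V K u x := by
  rw [← inner_add_coe u x, ← inner_add_coe u x] at hle
  have := hK.eq_of_mem_upperBoundary (hK.upperSection_mem_upperBoundary hu hx) hy
    (by rw [proj_add_coe, proj_add_coe]) hle
  exact Subtype.ext (add_left_cancel this)

theorem integrableOn_section {γ : V → Vᗮ} (hγ : Measurable γ)
    (hmem : ∀ x ∈ projBody V K, γ x ∈ fiber V K x) : IntegrableOn γ (projBody V K) := by
  obtain ⟨R, hR⟩ := K.exists_norm_fiber_le V
  exact IntegrableOn.of_bound (isCompact_projBody V K).measure_lt_top hγ.aestronglyMeasurable R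
    (ae_restrict_of_forall_mem (isCompact_projBody V K).measurableSet
      fun x hx => hR x _ (hmem x hx))

theorem IsCurved.integrableOn_upperSection (hK : IsCurved K) {u : Vᗮ} (hu : u ≠ 0) :
    IntegrableOn (upperSection V K u) (projBody V K) :=
  integrableOn_section (hK.measurable_upperSection hu) fun _ => hK.upperSection_mem_fiber hu

theorem IsCurved.isGreatest_inner_fiberBody (hK : IsCurved K) {u : Vᗮ} (hu : u ≠ 0) :
    IsGreatest ((fun y : Vᗮ => (inner ℝ u y : ℝ)) '' fiberBody V K)
      (inner ℝ u (∫ x in projBody V K, upperSection V K u x)) := by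
  refine ⟨⟨_, ⟨_, hK.measurable_upperSection hu, fun _ => hK.upperSection_mem_fiber hu, rfl⟩, rfl⟩,
    ?_⟩
  rintro _ ⟨_, ⟨γ, hγ, hmem, rfl⟩, rfl⟩
  have hi := integrableOn_section hγ hmem
  have hi' := hK.integrableOn_upperSection (V := V) hu
  dsimp only
  rw [← integral_inner hi, ← integral_inner hi']
  exact setIntegral_mono_on (hi.const_inner u) (hi'.const_inner u)
    (isCompact_projBody V K).measurableSet
    fun x hx => hK.inner_le_inner_upperSection hu hx (hmem x hx)

theorem IsCurved.supportFunction_fiberBody (hK : IsCurved K) {u : Vᗮ} (hu : u ≠ 0) :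
    supportFunction (fiberBody V K) u = inner ℝ u (∫ x in projBody V K, upperSection V K u x) :=
  (hK.isGreatest_inner_fiberBody hu).csSup_eq

/-- Needed for `u = 0`. If `W` is trivial, the zero section works; otherwise any nonzero direction
supplies a maximizer. -/
theorem IsCurved.fiberBody_nonempty (hK : IsCurved K) : (fiberBody V K).Nonempty := by
  rcases subsingleton_or_nontrivial Vᗮ with h | h
  · refine ⟨0, 0, measurable_const, fun x hx => ?_, Subsingleton.elim _ _⟩
    obtain ⟨z, hz, rfl⟩ := hx
    change _ ∈ K
    rw [Subsingleton.elim ((0 : V → Vᗮ) (V.orthogonalProjectionOnto z))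
      (Vᗮ.orthogonalProjectionOnto z), proj_coe_add_proj_orthogonal_coe]
    exact hz
  · obtain ⟨u, hu⟩ := exists_ne (0 : Vᗮ)
    exact (hK.isGreatest_inner_fiberBody hu).nonempty.of_image

/-- In the compact fiber, any cluster point of the maximizers for `w → u` maximizes `u`, hence is
the unique maximizer. -/
theorem IsCurved.tendsto_upperSection (hK : IsCurved K) {u : Vᗮ} (hu : u ≠ 0) {x : V}
    (hx : x ∈ projBody V K) :
    Filter.Tendsto (fun w => upperSection V K w x) (nhds u) (nhds (upperSection V K u x)) := by
  have hne : ∀ᶠ w in nhds u, w ≠ 0 := isOpen_compl_singleton.mem_nhds hu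
  refine (isCompact_fiber V K x).tendsto_nhds_of_unique_mapClusterPt
    (hne.mono fun w hw => hK.upperSection_mem_fiber hw hx) fun y hy hcl => ?_
  refine hK.eq_upperSection hu hx hy ?_
  obtain ⟨U, hU, hUy⟩ := mapClusterPt_iff_ultrafilter.1 hcl
  have hUu : Filter.Tendsto (fun w : Vᗮ => w) U (nhds u) := hU
  exact le_of_tendsto_of_tendsto (hUu.inner tendsto_const_nhds) (hUu.inner hUy)
    (hU (hne.mono fun w hw =>
      hK.inner_le_inner_upperSection hw hx (hK.upperSection_mem_fiber hu hx)))

theorem IsCurved.tendsto_integral_upperSection (hK : IsCurved K) {u : Vᗮ} (hu : u ≠ 0) :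
    Filter.Tendsto (fun w => ∫ x in projBody V K, upperSection V K w x) (nhds u)
      (nhds (∫ x in projBody V K, upperSection V K u x)) := by
  have hne : ∀ᶠ w in nhds u, w ≠ 0 := isOpen_compl_singleton.mem_nhds hu
  have hms := (isCompact_projBody V K).measurableSet
  obtain ⟨R, hR⟩ := K.exists_norm_fiber_le V
  refine tendsto_integral_filter_of_dominated_convergence (fun _ => R) ?_ ?_ ?_ ?_
  · exact hne.mono fun w hw => (hK.measurable_upperSection hw).aestronglyMeasurable
  · exact hne.mono fun w hw => ae_restrict_of_forall_mem hms fun x hx =>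
      hR x _ (hK.upperSection_mem_fiber hw hx)
  · exact integrableOn_const (isCompact_projBody V K).measure_lt_top.ne
  · exact ae_restrict_of_forall_mem hms fun x hx => hK.tendsto_upperSection hu hx

theorem IsCurved.hasGradientAt_supportFunction_fiberBody (hK : IsCurved K) {u : Vᗮ} (hu : u ≠ 0) :
    HasGradientAt (supportFunction (fiberBody V K))
      (∫ x in projBody V K, upperSection V K u x) u := by
  have hne : ∀ᶠ w in nhds u, w ≠ 0 := isOpen_compl_singleton.mem_nhds hu
  rw [hasGradientAt_iff_isLittleO, Asymptotics.isLittleO_iff]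
  intro c hc
  filter_upwards [hne, Metric.tendsto_nhds.1 (hK.tendsto_integral_upperSection hu) c hc]
    with w hw hdist
  set I := fun w => ∫ x in projBody V K, upperSection V K w x
  have hdist : ‖I w - I u‖ < c := by rwa [← dist_eq_norm]
  have hgw := hK.isGreatest_inner_fiberBody (V := V) hw
  have hgu := hK.isGreatest_inner_fiberBody (V := V) hu
  have hmem : ∀ {v : Vᗮ}, v ≠ 0 → I v ∈ fiberBody V K := fun hv =>
    ⟨_, hK.measurable_upperSection hv, fun _ => hK.upperSection_mem_fiber hv, rfl⟩
  have h1 : (inner ℝ w (I u) : ℝ) ≤ inner ℝ w (I w) := hgw.2 ⟨_, hmem hu, rfl⟩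
  have h2 : (inner ℝ u (I w) : ℝ) ≤ inner ℝ u (I u) := hgu.2 ⟨_, hmem hw, rfl⟩
  rw [hK.supportFunction_fiberBody hw, hK.supportFunction_fiberBody hu]
  change ‖(inner ℝ w (I w) : ℝ) - inner ℝ u (I u) - inner ℝ (I u) (w - u)‖ ≤ _
  -- With `h1` and `h2` the remainder lies between `0` and `⟪I w - I u, w - u⟫`, which
  -- Cauchy–Schwarz bounds by `c * ‖w - u‖`.
  rw [inner_sub_right, real_inner_comm w, real_inner_comm u (I u), Real.norm_of_nonneg
    (by linarith)]
  have h3 := real_inner_le_norm (I w - I u) (w - u)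
  rw [inner_sub_left, inner_sub_right, inner_sub_right, real_inner_comm w, real_inner_comm w,
    real_inner_comm u, real_inner_comm u] at h3
  have h4 := mul_le_mul_of_nonneg_right hdist.le (norm_nonneg (w - u))
  linarith

end Section

/-! ### The main theorem -/

theorem mainTheorem3 (n m : ℕ) (V : Submodule ℝ (EuclideanSpace ℝ (Fin (n + m))))
    (hV : Module.finrank ℝ V = n) (K : ConvexBody (EuclideanSpace ℝ (Fin (n + m))))
    (hK : IsCurved K) :
    (∀ u : Vᗮ,
      IsGreatest ((fun y : Vᗮ => inner ℝ u y) '' fiberBody V K)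
        (supportFunction (fiberBody V K) u) ∧
      Integrable (fun ξ : V =>
        inner ℝ (u : EuclideanSpace ℝ (Fin (n + m)))
          (gradient (supportFunction (K : Set (EuclideanSpace ℝ (Fin (n + m)))))
            ((u : EuclideanSpace ℝ (Fin (n + m))) + ξ)) * jacPsi V K u ξ) ∧
      supportFunction (fiberBody V K) u =
        ∫ ξ : V, inner ℝ (u : EuclideanSpace ℝ (Fin (n + m)))
          (gradient (supportFunction (K : Set (EuclideanSpace ℝ (Fin (n + m)))))
            ((u : EuclideanSpace ℝ (Fin (n + m))) + ξ)) * jacPsi V K u ξ) ∧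
    (∀ u : Vᗮ, ‖u‖ = 1 →
      Integrable (fun ξ : V => jacPsi V K u ξ • Vᗮ.orthogonalProjectionOnto
        (gradient (supportFunction (K : Set (EuclideanSpace ℝ (Fin (n + m)))))
          ((u : EuclideanSpace ℝ (Fin (n + m))) + ξ))) ∧
      HasGradientAt (supportFunction (fiberBody V K))
        (∫ ξ : V, jacPsi V K u ξ • Vᗮ.orthogonalProjectionOnto
          (gradient (supportFunction (K : Set (EuclideanSpace ℝ (Fin (n + m)))))
            ((u : EuclideanSpace ℝ (Fin (n + m))) + ξ))) u) := by
  refine ⟨fun u => ?_, fun u hu1 => ?_⟩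
  · rcases eq_or_ne u 0 with rfl | hu
    · obtain ⟨y, hy⟩ := hK.fiberBody_nonempty (V := V)
      have himg : (fun y : Vᗮ => (inner ℝ (0 : Vᗮ) y : ℝ)) '' fiberBody V K = {0} := by
        simp [Set.Nonempty.image_const ⟨y, hy⟩]
      have h0 : supportFunction (fiberBody V K) 0 = 0 := by
        rw [supportFunction, himg, csSup_singleton]
      refine ⟨?_, ?_, ?_⟩
      · rw [himg, h0]
        exact isGreatest_singleton
      · simp
      · simp [h0]
    · have hi : ∀ ξ : V, (inner ℝ (u : EuclideanSpace ℝ (Fin (n + m)))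
          (gradient (supportFunction (K : Set (EuclideanSpace ℝ (Fin (n + m)))))
            ((u : EuclideanSpace ℝ (Fin (n + m))) + ξ)) : ℝ) * jacPsi V K u ξ =
          jacPsi V K u ξ • (inner ℝ u (upperSection V K u (psi V K u ξ)) : ℝ) := fun ξ => by
        rw [hK.upperSection_psi hu, Submodule.inner_orthogonalProjectionOnto_eq_of_mem_left,
          smul_eq_mul, mul_comm]
      have hint := hK.integrableOn_upperSection (V := V) hu
      simp only [hi]
      refine ⟨?_, hK.integrable_jacPsi_smul hu
        (g := fun x => (inner ℝ u (upperSection V K u x) : ℝ)) (hint.const_inner u), ?_⟩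
      · rw [hK.supportFunction_fiberBody hu]
        exact hK.isGreatest_inner_fiberBody hu
      · rw [hK.supportFunction_fiberBody hu, ← integral_inner hint]
        exact hK.setIntegral_projBody hu fun x => (inner ℝ u (upperSection V K u x) : ℝ)
  · have hu : u ≠ 0 := by
      rintro rfl
      simp at hu1
    simp only [← hK.upperSection_psi hu]
    rw [← hK.setIntegral_projBody hu (upperSection V K u)]
    exact ⟨hK.integrable_jacPsi_smul hu (hK.integrableOn_upperSection hu),
      hK.hasGradientAt_supportFunction_fiberBody hu⟩
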